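/- All algebras are associative and unital. An $F$-algebra is affine if it is finitely generated as an $F$-algebra, and a ring is Noetherian if it is both left and right Noetherian. A Noetherian filtration of an $F$-algebra $R$ is a sequence of finite-dimensional $F$-subspaces $\mathcal F_0\subseteq\mathcal F_1\subseteq\cdots$ of $R$ with $1\in\mathcal F_0$, $\mathcal F_i\mathcal F_j\subseteq\mathcal F_{i+j}$ for all $i,j\ge 0$ and $\bigcup_i\mathcal F_i=R$, such that the associated graded algebra $\operatorname{gr}_{\mathcal F}(R)=\mathcal F_0\oplus\mathcal F_1/\mathcal F_0\oplus\mathcal F_2/\mathcal F_1\oplus\cdots$ is Noetherian. There exists a countable field $F$ such that the set of isomorphism classes of affine Noetherian $F$-algebras that admit no Noetherian filtration has cardinality $2^{\aleph_0}$, while the set of isomorphism classes of affine $F$-algebras that admit a Noetherian filtration is countable. -/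

import Mathlib

open scoped DirectSum

/-- A (not necessarily commutative) ring is Noetherian if it is both left Noetherian and right
Noetherian, i.e. it and its opposite ring satisfy the ascending chain condition on left ideals. -/
def IsTwoSidedNoetherian (R : Type*) [Ring R] : Prop :=
  IsNoetherianRing R ∧ IsNoetherianRing Rᵐᵒᵖ

/-- An exhaustive filtration `F·1 ⊆ 𝓕₀ ⊆ 𝓕₁ ⊆ ⋯` of an `F`-algebra `R` by finite-dimensional
subspaces with `𝓕ᵢ 𝓕ⱼ ⊆ 𝓕ᵢ₊ⱼ`. -/
structure FinDimFiltration (F R : Type*) [Field F] [Ring R] [Algebra F R] where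
  /-- the `i`-th term of the filtration -/
  term : ℕ → Submodule F R
  mono : Monotone term
  one_mem : (1 : R) ∈ term 0
  mul_mem : ∀ {i j : ℕ} {a b : R}, a ∈ term i → b ∈ term j → a * b ∈ term (i + j)
  finiteDimensional : ∀ i, FiniteDimensional F (term i)
  exhaustive : ∀ a : R, ∃ i, a ∈ term i

namespace FinDimFiltration

variable {F R : Type*} [Field F] [Ring R] [Algebra F R] (𝓕 : FinDimFiltration F R)

/-- The previous term `𝓕ᵢ₋₁` of the filtration, where `𝓕₋₁ = 0`. -/
def prev : ℕ → Submodule F R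
  | 0 => ⊥
  | i + 1 => 𝓕.term i

theorem mul_mem_prev_left {i j : ℕ} {a b : R} (ha : a ∈ 𝓕.prev i) (hb : b ∈ 𝓕.term j) :
    a * b ∈ 𝓕.prev (i + j) := by
  cases i with
  | zero =>
    have h : a = 0 := by simpa [prev] using ha
    simp [h]
  | succ i =>
    rw [Nat.succ_add_eq_add_succ i j]
    exact 𝓕.mul_mem ha hb

theorem mul_mem_prev_right {i j : ℕ} {a b : R} (ha : a ∈ 𝓕.term i) (hb : b ∈ 𝓕.prev j) :
    a * b ∈ 𝓕.prev (i + j) := by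
  cases j with
  | zero =>
    have h : b = 0 := by simpa [prev] using hb
    simp [h]
  | succ j => exact 𝓕.mul_mem ha hb

/-- The homogeneous component `𝓕ᵢ / 𝓕ᵢ₋₁` of the associated graded algebra. -/
def grPiece (i : ℕ) : Type _ := 𝓕.term i ⧸ (𝓕.prev i).submoduleOf (𝓕.term i)

instance (i : ℕ) : AddCommGroup (𝓕.grPiece i) :=
  inferInstanceAs (AddCommGroup (𝓕.term i ⧸ (𝓕.prev i).submoduleOf (𝓕.term i)))

instance (i : ℕ) : Module F (𝓕.grPiece i) :=
  inferInstanceAs (Module F (𝓕.term i ⧸ (𝓕.prev i).submoduleOf (𝓕.term i)))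

/-- The class in `𝓕ᵢ / 𝓕ᵢ₋₁` of an element of `𝓕ᵢ`. -/
def grMk (i : ℕ) (a : 𝓕.term i) : 𝓕.grPiece i := Submodule.Quotient.mk a

/-- The multiplication `𝓕ᵢ / 𝓕ᵢ₋₁ × 𝓕ⱼ / 𝓕ⱼ₋₁ → 𝓕ᵢ₊ⱼ / 𝓕ᵢ₊ⱼ₋₁` induced by that of `R`. -/
def grMul {i j : ℕ} (x : 𝓕.grPiece i) (y : 𝓕.grPiece j) : 𝓕.grPiece (i + j) :=
  Quotient.liftOn₂' x y (fun a b => 𝓕.grMk (i + j) ⟨a.1 * b.1, 𝓕.mul_mem a.2 b.2⟩) (by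
    intro a b a' b' ha hb
    rw [Submodule.quotientRel_def] at ha hb
    refine (Submodule.Quotient.eq _).2 ?_
    have ha' : (a.1 - a'.1) ∈ 𝓕.prev i := ha
    have hb' : (b.1 - b'.1) ∈ 𝓕.prev j := hb
    have h := add_mem (𝓕.mul_mem_prev_left ha' b.2) (𝓕.mul_mem_prev_right a'.2 hb')
    have e : (a.1 - a'.1) * b.1 + a'.1 * (b.1 - b'.1) = a.1 * b.1 - a'.1 * b'.1 := by
      noncomm_ring
    rw [e] at h
    exact h)

theorem grMul_mk {i j : ℕ} (a : 𝓕.term i) (b : 𝓕.term j) :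
    𝓕.grMul (𝓕.grMk i a) (𝓕.grMk j b) = 𝓕.grMk (i + j) ⟨a.1 * b.1, 𝓕.mul_mem a.2 b.2⟩ := rfl

theorem grMk_surjective {i : ℕ} (x : 𝓕.grPiece i) : ∃ a, 𝓕.grMk i a = x :=
  Submodule.Quotient.mk_surjective _ x

theorem gradedMonoid_mk_eq {i j : ℕ} (h : i = j) {a : 𝓕.term i} {b : 𝓕.term j}
    (hab : a.1 = b.1) :
    GradedMonoid.mk (A := 𝓕.grPiece) i (𝓕.grMk i a) = GradedMonoid.mk j (𝓕.grMk j b) := by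
  subst h
  rw [Subtype.ext hab]

instance : GradedMonoid.GOne 𝓕.grPiece := ⟨𝓕.grMk 0 ⟨1, 𝓕.one_mem⟩⟩

instance : GradedMonoid.GMul 𝓕.grPiece := ⟨fun x y => 𝓕.grMul x y⟩

/-- The graded ring structure on the family of the `𝓕ᵢ / 𝓕ᵢ₋₁`. -/
instance : DirectSum.GRing 𝓕.grPiece where
  mul_zero x := by
    obtain ⟨a, rfl⟩ := 𝓕.grMk_surjective x
    exact congrArg (𝓕.grMk _) (Subtype.ext (mul_zero a.1))
  zero_mul x := by
    obtain ⟨a, rfl⟩ := 𝓕.grMk_surjective x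
    exact congrArg (𝓕.grMk _) (Subtype.ext (zero_mul a.1))
  mul_add x y z := by
    obtain ⟨a, rfl⟩ := 𝓕.grMk_surjective x
    obtain ⟨b, rfl⟩ := 𝓕.grMk_surjective y
    obtain ⟨c, rfl⟩ := 𝓕.grMk_surjective z
    exact congrArg (𝓕.grMk _) (Subtype.ext (mul_add a.1 b.1 c.1))
  add_mul x y z := by
    obtain ⟨a, rfl⟩ := 𝓕.grMk_surjective x
    obtain ⟨b, rfl⟩ := 𝓕.grMk_surjective y
    obtain ⟨c, rfl⟩ := 𝓕.grMk_surjective z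
    exact congrArg (𝓕.grMk _) (Subtype.ext (add_mul a.1 b.1 c.1))
  one_mul := by
    rintro ⟨i, x⟩
    obtain ⟨a, rfl⟩ := 𝓕.grMk_surjective x
    exact 𝓕.gradedMonoid_mk_eq (zero_add i) (one_mul a.1)
  mul_one := by
    rintro ⟨i, x⟩
    obtain ⟨a, rfl⟩ := 𝓕.grMk_surjective x
    exact 𝓕.gradedMonoid_mk_eq (add_zero i) (mul_one a.1)
  mul_assoc := by
    rintro ⟨i, x⟩ ⟨j, y⟩ ⟨k, z⟩
    obtain ⟨a, rfl⟩ := 𝓕.grMk_surjective x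
    obtain ⟨b, rfl⟩ := 𝓕.grMk_surjective y
    obtain ⟨c, rfl⟩ := 𝓕.grMk_surjective z
    exact 𝓕.gradedMonoid_mk_eq (add_assoc i j k) (mul_assoc a.1 b.1 c.1)
  natCast n := n • 𝓕.grMk 0 ⟨1, 𝓕.one_mem⟩
  natCast_zero := zero_nsmul _
  natCast_succ n := succ_nsmul _ n
  intCast n := n • 𝓕.grMk 0 ⟨1, 𝓕.one_mem⟩
  intCast_ofNat n := natCast_zsmul _ n
  intCast_negSucc_ofNat n := negSucc_zsmul _ n

/-- The associated graded algebra `gr 𝓕 R = 𝓕₀ ⊕ 𝓕₁/𝓕₀ ⊕ 𝓕₂/𝓕₁ ⊕ ⋯` as a ring. -/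
abbrev gr : Type _ := ⨁ i, 𝓕.grPiece i

end FinDimFiltration

/-- `R` admits a Noetherian filtration: a finite-dimensional filtration with Noetherian
associated graded algebra. -/
def HasNoetherianFiltration (F R : Type*) [Field F] [Ring R] [Algebra F R] : Prop :=
  ∃ 𝓕 : FinDimFiltration F R, IsTwoSidedNoetherian 𝓕.gr

/-- Isomorphism of (associative, unital) `F`-algebras. -/
def algIsoSetoid (F : Type) [Field F] : Setoid (AlgCat.{0} F) where
  r A B := Nonempty (A ≃ₐ[F] B)
  iseqv :=
    { refl := fun _ => ⟨AlgEquiv.refl⟩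
      symm := fun ⟨e⟩ => ⟨e.symm⟩
      trans := fun ⟨e⟩ ⟨f⟩ => ⟨e.trans f⟩ }

/-- The set of isomorphism classes of those `F`-algebras that satisfy `P`. -/
def isoClasses (F : Type) [Field F] (P : AlgCat.{0} F → Prop) : Set (Quotient (algIsoSetoid F)) :=
  {c | ∃ A : AlgCat.{0} F, P A ∧ Quotient.mk (algIsoSetoid F) A = c}

/-! ### Symbols, and generation in bounded degree -/

namespace FinDimFiltration

variable {F R : Type*} [Field F] [Ring R] [Algebra F R] (𝓕 : FinDimFiltration F R)

/-- The filtration indexed by the integers, zero in negative degrees. -/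
def zterm : ℤ → Submodule F R
  | Int.ofNat n => 𝓕.term n
  | Int.negSucc _ => ⊥

theorem zterm_natCast (n : ℕ) : 𝓕.zterm n = 𝓕.term n := rfl

theorem zterm_of_neg {n : ℤ} (h : n < 0) : 𝓕.zterm n = ⊥ := by
  cases n with
  | ofNat n => simp at h; omega
  | negSucc n => rfl

theorem zterm_sub_one (n : ℕ) : 𝓕.zterm (n - 1) = 𝓕.prev n := by
  cases n with
  | zero => rfl
  | succ n =>
    rw [Nat.cast_succ, add_sub_cancel_right]
    rfl

theorem zterm_mono : Monotone 𝓕.zterm := by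
  intro m n h
  rcases lt_or_ge m 0 with hm | hm
  · rw [𝓕.zterm_of_neg hm]
    exact bot_le
  · lift m to ℕ using hm
    lift n to ℕ using by omega
    exact 𝓕.mono (by exact_mod_cast h)

theorem zterm_mem_of_le {m n : ℤ} (h : m ≤ n) {a : R} (ha : a ∈ 𝓕.zterm m) : a ∈ 𝓕.zterm n :=
  𝓕.zterm_mono h ha

theorem mul_mem_zterm {i j k : ℤ} (h : i + j ≤ k) {a b : R} (ha : a ∈ 𝓕.zterm i)
    (hb : b ∈ 𝓕.zterm j) : a * b ∈ 𝓕.zterm k := by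
  rcases lt_or_ge i 0 with hi | hi
  · rw [𝓕.zterm_of_neg hi, Submodule.mem_bot] at ha
    simp [ha]
  rcases lt_or_ge j 0 with hj | hj
  · rw [𝓕.zterm_of_neg hj, Submodule.mem_bot] at hb
    simp [hb]
  lift i to ℕ using hi
  lift j to ℕ using hj
  refine 𝓕.zterm_mem_of_le h ?_
  exact_mod_cast 𝓕.mul_mem ha hb

theorem one_mem_zterm : (1 : R) ∈ 𝓕.zterm 0 := 𝓕.one_mem

theorem exists_mem_zterm (a : R) : ∃ n : ℕ, a ∈ 𝓕.zterm n := 𝓕.exhaustive a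

open Classical in
/-- The symbol in degree `n` of an element of `𝓕ₙ` (and zero elsewhere). -/
noncomputable def symbol : ℤ → R → 𝓕.gr
  | Int.ofNat n, a => if h : a ∈ 𝓕.term n then DirectSum.of 𝓕.grPiece n (𝓕.grMk n ⟨a, h⟩) else 0
  | Int.negSucc _, _ => 0

theorem symbol_natCast {n : ℕ} {a : R} (h : a ∈ 𝓕.term n) :
    𝓕.symbol n a = DirectSum.of 𝓕.grPiece n (𝓕.grMk n ⟨a, h⟩) := dif_pos h

theorem symbol_of_neg {n : ℤ} (h : n < 0) (a : R) : 𝓕.symbol n a = 0 := by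
  cases n with
  | ofNat n => simp at h; omega
  | negSucc n => rfl

theorem symbol_add {n : ℤ} {a b : R} (ha : a ∈ 𝓕.zterm n) (hb : b ∈ 𝓕.zterm n) :
    𝓕.symbol n (a + b) = 𝓕.symbol n a + 𝓕.symbol n b := by
  rcases lt_or_ge n 0 with hn | hn
  · simp [𝓕.symbol_of_neg hn]
  lift n to ℕ using hn
  rw [𝓕.symbol_natCast ha, 𝓕.symbol_natCast hb, 𝓕.symbol_natCast (add_mem ha hb), ← map_add]
  rfl

theorem symbol_zero (n : ℤ) : 𝓕.symbol n 0 = 0 := by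
  have h := 𝓕.symbol_add (zero_mem (𝓕.zterm n)) (zero_mem (𝓕.zterm n))
  simpa using h

theorem symbol_mul {i j : ℤ} {a b : R} (ha : a ∈ 𝓕.zterm i) (hb : b ∈ 𝓕.zterm j) :
    𝓕.symbol i a * 𝓕.symbol j b = 𝓕.symbol (i + j) (a * b) := by
  rcases lt_or_ge i 0 with hi | hi
  · rw [𝓕.zterm_of_neg hi, Submodule.mem_bot] at ha
    simp [ha, symbol_zero]
  rcases lt_or_ge j 0 with hj | hj
  · rw [𝓕.zterm_of_neg hj, Submodule.mem_bot] at hb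
    simp [hb, symbol_zero]
  lift i to ℕ using hi
  lift j to ℕ using hj
  rw [𝓕.symbol_natCast ha, 𝓕.symbol_natCast hb, DirectSum.of_mul_of, ← Nat.cast_add,
    𝓕.symbol_natCast (𝓕.mul_mem ha hb)]
  rfl

theorem mem_of_symbol_eq {n : ℤ} {a b : R} (ha : a ∈ 𝓕.zterm n) (hb : b ∈ 𝓕.zterm n)
    (h : 𝓕.symbol n a = 𝓕.symbol n b) : a - b ∈ 𝓕.zterm (n - 1) := by
  rcases lt_or_ge n 0 with hn | hn
  · rw [𝓕.zterm_of_neg hn, Submodule.mem_bot] at ha hb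
    simp [ha, hb]
  lift n to ℕ using hn
  rw [𝓕.symbol_natCast ha, 𝓕.symbol_natCast hb] at h
  have h' := (Submodule.Quotient.eq _).1 (DirectSum.of_injective n h)
  rw [zterm_sub_one]
  exact h'

/-- The projection of the associated graded ring to its homogeneous component of degree `n`. -/
noncomputable def proj (n : ℤ) : 𝓕.gr →+ 𝓕.gr :=
  if 0 ≤ n then
    (DirectSum.of 𝓕.grPiece n.toNat).comp
      (DFinsupp.evalAddMonoidHom (β := 𝓕.grPiece) n.toNat)
  else 0

theorem proj_symbol_self (n : ℤ) (a : R) : 𝓕.proj n (𝓕.symbol n a) = 𝓕.symbol n a := by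
  rcases lt_or_ge n 0 with hn | hn
  · simp [𝓕.symbol_of_neg hn]
  lift n to ℕ using hn
  by_cases h : a ∈ 𝓕.term n
  · rw [𝓕.symbol_natCast h]
    simp only [proj, Nat.cast_nonneg, if_true, Int.toNat_natCast, AddMonoidHom.comp_apply]
    exact congrArg _ (DirectSum.of_eq_same n _)
  · have : 𝓕.symbol n a = 0 := dif_neg h
    simp [this]

theorem proj_symbol_of_ne {m n : ℤ} (hmn : m ≠ n) (a : R) : 𝓕.proj n (𝓕.symbol m a) = 0 := by
  rcases lt_or_ge m 0 with hm | hm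
  · simp [𝓕.symbol_of_neg hm]
  rcases lt_or_ge n 0 with hn | hn
  · simp [proj, not_le.2 hn]
  lift n to ℕ using hn
  lift m to ℕ using hm
  by_cases h : a ∈ 𝓕.term m
  · rw [𝓕.symbol_natCast h]
    simp only [proj, Nat.cast_nonneg, if_true, Int.toNat_natCast, AddMonoidHom.comp_apply]
    have : (DFinsupp.evalAddMonoidHom (β := 𝓕.grPiece) n)
        (DirectSum.of 𝓕.grPiece m (𝓕.grMk m ⟨a, h⟩)) = 0 :=
      DirectSum.of_eq_of_ne m n _ (fun h => hmn (by rw [h]))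
    rw [this, map_zero]
  · have : 𝓕.symbol m a = 0 := dif_neg h
    simp [this]

theorem gr_induction {p : 𝓕.gr → Prop} (g : 𝓕.gr) (zero : p 0)
    (symbol : ∀ (n : ℤ) (a : R), a ∈ 𝓕.zterm n → p (𝓕.symbol n a))
    (add : ∀ x y, p x → p y → p (x + y)) : p g := by
  induction g using DirectSum.induction_on with
  | zero => exact zero
  | of i x =>
    obtain ⟨a, rfl⟩ := 𝓕.grMk_surjective x
    rw [← 𝓕.symbol_natCast a.2]
    exact symbol i a a.2
  | add x y hx hy => exact add x y hx hy

/-- A graded consequence of the ascending chain condition: given any sets `X k` of tuples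
homogeneous of degree `k` (with shifts `d`), finitely many degrees generate all the others up to
terms of lower order. -/
theorem exists_bound_generation (hG : IsNoetherianRing 𝓕.gr) {ι : Type*} [Finite ι] (d : ι → ℤ)
    (X : ℕ → Set (ι → R)) (hX : ∀ k, ∀ y ∈ X k, ∀ i, y i ∈ 𝓕.zterm (k - d i)) :
    ∃ N : ℕ, ∀ k, ∀ y ∈ X k,
      ∃ u ∈ Submodule.span F {w : ι → R | ∃ (e : ℕ) (h : R) (y : ι → R), e ≤ N ∧
        h ∈ 𝓕.zterm (k - e) ∧ y ∈ X e ∧ w = h • y},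
        ∀ i, y i - u i ∈ 𝓕.zterm (k - 1 - d i) := by
  classical
  set sym : ℤ → (ι → R) → (ι → 𝓕.gr) := fun k y i => 𝓕.symbol (k - d i) (y i) with hsym
  -- The submodules generated by the symbols of `X 0, …, X n` form an ascending chain in a
  -- Noetherian module; `N` is where it stabilizes.
  let M : ℕ →o Submodule 𝓕.gr (ι → 𝓕.gr) :=
    ⟨fun n => Submodule.span 𝓕.gr {w | ∃ e ≤ n, ∃ y ∈ X e, w = sym e y}, fun a b hab =>
      Submodule.span_mono fun w ⟨e, he, h⟩ => ⟨e, he.trans hab, h⟩⟩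
  have : IsNoetherian 𝓕.gr (ι → 𝓕.gr) := inferInstance
  obtain ⟨N, hN⟩ := monotone_stabilizes_iff_noetherian.2 this M
  refine ⟨N, fun k y hy => ?_⟩
  set S : ℤ → Submodule F (ι → R) := fun k => Submodule.span F {w : ι → R |
    ∃ (e : ℕ) (h : R) (y : ι → R), e ≤ N ∧ h ∈ 𝓕.zterm (k - e) ∧ y ∈ X e ∧ w = h • y} with hS
  have hSmem : ∀ k, ∀ u ∈ S k, ∀ i, u i ∈ 𝓕.zterm (k - d i) := by
    intro k u hu
    induction hu using Submodule.span_induction with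
    | mem w hw =>
      obtain ⟨e, h, y, -, hh, hy, rfl⟩ := hw
      exact fun i => 𝓕.mul_mem_zterm (by omega) hh (hX e y hy i)
    | zero => exact fun i => zero_mem _
    | add a b _ _ ha hb => exact fun i => add_mem (ha i) (hb i)
    | smul c a _ ha => exact fun i => Submodule.smul_mem _ _ (ha i)
  have hSmul : ∀ (j k : ℤ) (a : R), a ∈ 𝓕.zterm j → ∀ u ∈ S k, a • u ∈ S (j + k) := by
    intro j k a ha u hu
    induction hu using Submodule.span_induction with
    | mem w hw =>
      obtain ⟨e, h, y, he, hh, hy, rfl⟩ := hw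
      exact Submodule.subset_span ⟨e, a * h, y, he, 𝓕.mul_mem_zterm (by omega) ha hh, hy,
        (mul_smul a h y).symm⟩
    | zero => simp
    | add u v _ _ hu hv =>
      rw [smul_add]
      exact add_mem hu hv
    | smul c u _ hu =>
      rw [smul_comm]
      exact Submodule.smul_mem _ _ hu
  -- Sums of homogeneous vectors that lift to some `S k`. They absorb multiplication by symbols, so
  -- they contain `M N`; projecting to one degree then recovers a single lift.
  let C : AddSubmonoid (ι → 𝓕.gr) := AddSubmonoid.closure {w | ∃ k, ∃ u ∈ S k, w = sym k u}
  have hMC : ∀ w ∈ M N, w ∈ C := by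
    intro w hw
    induction hw using Submodule.span_induction with
    | mem w hw =>
      obtain ⟨e, he, y, hy, rfl⟩ := hw
      refine AddSubmonoid.subset_closure ⟨e, y, Submodule.subset_span ⟨e, 1, y, he, ?_, hy, ?_⟩, rfl⟩
      · rw [sub_self]
        exact 𝓕.one_mem_zterm
      · rw [one_smul]
    | zero => exact zero_mem _
    | add a b _ _ ha hb => exact add_mem ha hb
    | smul g w hwM hw =>
      clear hwM
      induction hw using AddSubmonoid.closure_induction with
      | zero => simp
      | add x y _ _ hx hy =>
        rw [smul_add]
        exact add_mem hx hy
      | mem w hw =>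
        obtain ⟨k, u, hu, rfl⟩ := hw
        induction g using 𝓕.gr_induction with
        | zero => simp
        | add x y hx hy =>
          rw [add_smul]
          exact add_mem hx hy
        | symbol n a ha =>
          refine AddSubmonoid.subset_closure ⟨n + k, a • u, hSmul n k a ha u hu, ?_⟩
          funext i
          have := 𝓕.symbol_mul ha (hSmem k u hu i)
          rw [← add_sub_assoc] at this
          exact this
  have hC : ∀ w ∈ C, ∀ k, ∃ u ∈ S k, ∀ i, 𝓕.proj (k - d i) (w i) = 𝓕.symbol (k - d i) (u i) := by
    intro w hw k
    induction hw using AddSubmonoid.closure_induction with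
    | zero => exact ⟨0, zero_mem _, fun i => by simp [symbol_zero]⟩
    | add x y _ _ hx hy =>
      obtain ⟨u, hu, hxu⟩ := hx
      obtain ⟨v, hv, hyv⟩ := hy
      refine ⟨u + v, add_mem hu hv, fun i => ?_⟩
      rw [Pi.add_apply, map_add, hxu, hyv, Pi.add_apply,
        𝓕.symbol_add (hSmem k u hu i) (hSmem k v hv i)]
    | mem w hw =>
      obtain ⟨k', u, hu, rfl⟩ := hw
      rcases eq_or_ne k' k with rfl | hk
      · exact ⟨u, hu, fun i => 𝓕.proj_symbol_self _ _⟩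
      · refine ⟨0, zero_mem _, fun i => ?_⟩
        rw [Pi.zero_apply, symbol_zero]
        exact 𝓕.proj_symbol_of_ne (by omega) _
  have hyM : sym k y ∈ M N := by
    have h : sym k y ∈ M (max N k) :=
      Submodule.subset_span ⟨k, le_max_right _ _, y, hy, rfl⟩
    rwa [← hN _ (le_max_left _ _)] at h
  obtain ⟨u, hu, huy⟩ := hC _ (hMC _ hyM) k
  refine ⟨u, hu, fun i => ?_⟩
  have h := 𝓕.mem_of_symbol_eq (hX k y hy i) (hSmem k u hu i) (by
    rw [← huy i]
    exact (𝓕.proj_symbol_self _ _).symm)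
  rwa [sub_right_comm] at h

end FinDimFiltration

/-! ### Extending partial homomorphisms by one level -/

/-- The map `g` descends to `P / ker f`, which is the range of `f`, and over a field a map on a
subspace extends to the whole space. -/
theorem LinearMap.exists_comp_eq_of_ker_le {K P V W : Type*} [Field K] [AddCommGroup P]
    [Module K P] [AddCommGroup V] [Module K V] [AddCommGroup W] [Module K W] (f : P →ₗ[K] V)
    (g : P →ₗ[K] W) (h : LinearMap.ker f ≤ LinearMap.ker g) : ∃ l : V →ₗ[K] W, l ∘ₗ f = g := by
  obtain ⟨l, hl⟩ := LinearMap.exists_extend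
    (((LinearMap.ker f).liftQ g h) ∘ₗ f.quotKerEquivRange.symm.toLinearMap)
  refine ⟨l, LinearMap.ext fun x => ?_⟩
  have h1 : l (f x) = (l ∘ₗ (LinearMap.range f).subtype) (f.rangeRestrict x) := rfl
  rw [LinearMap.comp_apply, h1, hl, LinearMap.comp_apply]
  have : f.quotKerEquivRange.symm (f.rangeRestrict x) = Submodule.Quotient.mk x := by
    rw [LinearEquiv.symm_apply_eq]
    rfl
  erw [this]
  rfl

namespace FinDimFiltration

variable {F R : Type*} [Field F] [Ring R] [Algebra F R] (𝓕 : FinDimFiltration F R)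

/-- If the associated graded ring is Noetherian, finitely many homogeneous elements of positive
degree generate it over its component of degree zero. -/
theorem exists_finite_generators (hG : IsNoetherianRing 𝓕.gr) :
    ∃ (m : ℕ) (d : Fin m → ℕ) (x : Fin m → R), (∀ i, 1 ≤ d i) ∧ (∀ i, x i ∈ 𝓕.zterm (d i)) ∧
      ∀ k : ℤ, 1 ≤ k → ∀ a ∈ 𝓕.zterm k, ∃ c : Fin m → R, (∀ i, c i ∈ 𝓕.zterm (k - d i)) ∧
        a - ∑ i, c i * x i ∈ 𝓕.zterm (k - 1) := by
  classical
  -- Single elements of positive degree: `X k` is all of `𝓕ₖ` for `k ≥ 1`, and `X 0` is empty.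
  -- Spanning sets of `𝓕₁, …, 𝓕_N` then supply the generators.
  obtain ⟨N, hN⟩ := 𝓕.exists_bound_generation hG (ι := Unit) (fun _ => 0)
    (fun k => {y | 1 ≤ k ∧ y () ∈ 𝓕.zterm k}) (fun k y hy i => by simpa using hy.2)
  have hfg : ∀ n : ℕ, ∃ s : Finset R, Submodule.span F (s : Set R) = 𝓕.term n := fun n => by
    have := 𝓕.finiteDimensional n
    exact (Submodule.fg_iff_finiteDimensional _).2 this
  choose s hs using hfg
  let T : Finset (Σ _ : ℕ, R) := (Finset.Icc 1 N).sigma s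
  let e := T.equivFin
  have hT : ∀ i : Fin T.card, 1 ≤ (e.symm i).1.1 ∧ (e.symm i).1.1 ≤ N ∧
      (e.symm i).1.2 ∈ s (e.symm i).1.1 := fun i => by
    obtain ⟨h1, h2⟩ := Finset.mem_sigma.1 (e.symm i).2
    exact ⟨(Finset.mem_Icc.1 h1).1, (Finset.mem_Icc.1 h1).2, h2⟩
  refine ⟨T.card, fun i => (e.symm i).1.1, fun i => (e.symm i).1.2, fun i => (hT i).1,
    fun i => ?_, fun k hk a ha => ?_⟩
  · rw [zterm_natCast, ← hs]
    exact Submodule.subset_span (hT i).2.2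
  lift k to ℕ using by omega
  obtain ⟨u, hu, hau⟩ := hN k (fun _ => a) ⟨by exact_mod_cast hk, ha⟩
  have key : ∃ c : Fin T.card → R, (∀ i, c i ∈ 𝓕.zterm (k - (e.symm i).1.1)) ∧
      u () = ∑ i, c i * (e.symm i).1.2 := by
    clear hau
    induction hu using Submodule.span_induction with
    | zero => exact ⟨0, fun i => zero_mem _, by simp⟩
    | add u v _ _ hu hv =>
      obtain ⟨c, hc, hcu⟩ := hu
      obtain ⟨c', hc', hcv⟩ := hv
      exact ⟨c + c', fun i => add_mem (hc i) (hc' i), by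
        simp [hcu, hcv, add_mul, Finset.sum_add_distrib]⟩
    | smul r u _ hu =>
      obtain ⟨c, hc, hcu⟩ := hu
      exact ⟨r • c, fun i => Submodule.smul_mem _ _ (hc i), by simp [hcu, Finset.smul_sum]⟩
    | mem w hw =>
      obtain ⟨n, h, y, hn, hh, ⟨hn1, hy⟩, rfl⟩ := hw
      rw [Pi.smul_apply, smul_eq_mul]
      rw [zterm_natCast, ← hs] at hy
      generalize y () = y₀ at hy
      induction hy using Submodule.span_induction with
      | zero => exact ⟨0, fun i => zero_mem _, by simp⟩
      | add u v _ _ hu hv =>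
        obtain ⟨c, hc, hcu⟩ := hu
        obtain ⟨c', hc', hcv⟩ := hv
        exact ⟨c + c', fun i => add_mem (hc i) (hc' i), by
          simp [hcu, hcv, add_mul, mul_add, Finset.sum_add_distrib]⟩
      | smul r u _ hu =>
        obtain ⟨c, hc, hcu⟩ := hu
        exact ⟨r • c, fun i => Submodule.smul_mem _ _ (hc i), by simp [hcu, Finset.smul_sum]⟩
      | mem z hz =>
        have hzT : (⟨n, z⟩ : Σ _ : ℕ, R) ∈ T := by
          simpa [T] using ⟨⟨hn1, hn⟩, hz⟩
        refine ⟨Pi.single (e ⟨_, hzT⟩) h, fun i => ?_, ?_⟩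
        · rcases eq_or_ne i (e ⟨_, hzT⟩) with rfl | hi
          · simpa using hh
          · simp [hi]
        · rw [Finset.sum_eq_single (e ⟨_, hzT⟩)]
          · simp
          · intro i _ hi
            simp [hi]
          · simp
  obtain ⟨c, hc, hcu⟩ := key
  refine ⟨c, hc, ?_⟩
  rw [← hcu]
  simpa using hau ()

/-- A linear map that is compatible with those products that are visible in `𝓕ₖ`. -/
structure IsPartialHom {B : Type*} [Ring B] [Algebra F B] (k : ℤ) (φ : R →ₗ[F] B) : Prop where
  map_one : φ 1 = 1
  map_mul : ∀ {i j : ℤ} {a b : R}, i + j ≤ k → a ∈ 𝓕.zterm i → b ∈ 𝓕.zterm j →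
    φ (a * b) = φ a * φ b

/-- If the associated graded ring is left Noetherian, then partial homomorphisms of sufficiently
high level extend to the next level. -/
theorem exists_partialHom_succ (hG : IsNoetherianRing 𝓕.gr) :
    ∃ N : ℕ, ∀ k : ℕ, N ≤ k → ∀ {B : Type*} [Ring B] [Algebra F B] (φ : R →ₗ[F] B),
      𝓕.IsPartialHom k φ →
        ∃ φ' : R →ₗ[F] B, 𝓕.IsPartialHom (k + 1) φ' ∧ ∀ a ∈ 𝓕.zterm k, φ' a = φ a := by
  obtain ⟨m, d, x, hd, hx, hgen⟩ := 𝓕.exists_finite_generators hG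
  -- Here `X k` lifts the degree-`k` syzygies of the symbols of the `x i`: the sum `∑ y i * x i`
  -- drops to `𝓕ₖ₋₁`.
  obtain ⟨N, hN⟩ := 𝓕.exists_bound_generation hG (fun i => (d i : ℤ))
    (fun k => {y | (∀ i, y i ∈ 𝓕.zterm (k - d i)) ∧ ∑ i, y i * x i ∈ 𝓕.zterm (k - 1)})
    (fun k y hy => hy.1)
  -- The summand `∑ i, d i` ensures `d i ≤ k`, needed only when the right factor has degree zero.
  refine ⟨N + ∑ i, d i, fun k hk B _ _ φ hφ => ?_⟩
  have hdk : ∀ i, d i ≤ k := fun i =>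
    ((Finset.single_le_sum (fun _ _ => Nat.zero_le _) (Finset.mem_univ i)).trans
      (Nat.le_add_left _ N)).trans hk
  have hd' : ∀ i, (1 : ℤ) ≤ d i := fun i => by exact_mod_cast hd i
  have hNk : N ≤ k := (Nat.le_add_right _ _).trans hk
  -- `P` parametrizes the expressions `∑ a i * x i + c` that exhaust `𝓕ₖ₊₁`; `θ` evaluates them and
  -- `ψ` gives the value forced on an extension of `φ`. The extension exists once `θ = 0` implies `ψ
  -- = 0` on `P`.
  let P : Submodule F ((Fin m → R) × R) :=
    (Submodule.pi Set.univ fun i => 𝓕.zterm (k + 1 - d i)).prod (𝓕.zterm k)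
  let θ : (Fin m → R) × R →ₗ[F] R :=
    (∑ i, LinearMap.mulRight F (x i) ∘ₗ LinearMap.proj i ∘ₗ LinearMap.fst F _ _) +
      LinearMap.snd F _ _
  let ψ : (Fin m → R) × R →ₗ[F] B :=
    (∑ i, LinearMap.mulRight F (φ (x i)) ∘ₗ φ ∘ₗ LinearMap.proj i ∘ₗ LinearMap.fst F _ _) +
      φ ∘ₗ LinearMap.snd F _ _
  have hθ : ∀ a c, θ (a, c) = ∑ i, a i * x i + c := fun a c => by simp [θ]
  have hψ : ∀ a c, ψ (a, c) = ∑ i, φ (a i) * φ (x i) + φ c := fun a c => by simp [ψ]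
  have hker : LinearMap.ker (θ ∘ₗ P.subtype) ≤ LinearMap.ker (ψ ∘ₗ P.subtype) := by
    rintro ⟨⟨a, c⟩, ha, hc⟩ h0
    have ha : ∀ i, a i ∈ 𝓕.zterm (k + 1 - d i) := by simpa using ha
    have hc : c ∈ 𝓕.zterm k := hc
    have h0 : ∑ i, a i * x i + c = 0 := by
      rw [← hθ]
      exact h0
    have hac : ∑ i, a i * x i = -c := eq_neg_of_add_eq_zero_left h0
    obtain ⟨u, hu, hau⟩ := hN (k + 1) a ⟨fun i => by
      push_cast
      exact ha i, by
      rw [hac]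
      push_cast
      rw [add_sub_cancel_right]
      exact neg_mem hc⟩
    -- For a generating syzygy `h • y` of degree `e ≤ N ≤ k`, every product stays within level `k`:
    -- `∑ y i * x i` lies in `𝓕ₑ₋₁`, and `h * y i` in level `k + 1 - d i ≤ k`.
    have key : ∑ i, u i * x i ∈ 𝓕.zterm k ∧
        ∑ i, φ (u i) * φ (x i) = φ (∑ i, u i * x i) := by
      clear hau
      induction hu using Submodule.span_induction with
      | zero => simp
      | add u v _ _ hu hv =>
        simp only [Pi.add_apply, add_mul, map_add, Finset.sum_add_distrib]
        exact ⟨add_mem hu.1 hv.1, by rw [hu.2, hv.2]⟩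
      | smul r u _ hu =>
        simp only [Pi.smul_apply, smul_mul_assoc, map_smul, ← Finset.smul_sum]
        exact ⟨Submodule.smul_mem _ _ hu.1, by rw [hu.2]⟩
      | mem w hw =>
        obtain ⟨e, h, y, he, hh, ⟨hy, hys⟩, rfl⟩ := hw
        have hek : e ≤ k := he.trans hNk
        push_cast at hh
        simp only [Pi.smul_apply, smul_eq_mul, mul_assoc, ← Finset.mul_sum]
        refine ⟨𝓕.mul_mem_zterm (by omega) hh hys, ?_⟩
        rw [hφ.map_mul (by omega) hh hys, map_sum, Finset.mul_sum]
        refine Finset.sum_congr rfl fun i _ => ?_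
        have := hd' i
        rw [hφ.map_mul (by omega) hh (hy i), hφ.map_mul (by omega) (hy i) (hx i), mul_assoc]
    have hau' : ∀ i, φ (a i) * φ (x i) - φ (u i) * φ (x i) = φ ((a i - u i) * x i) := fun i => by
      have h := hau i
      push_cast at h
      rw [hφ.map_mul (by omega) h (hx i), map_sub, sub_mul]
    have : ∑ i, φ (a i) * φ (x i) = φ (∑ i, a i * x i) := by
      rw [← sub_eq_zero, ← sub_add_sub_cancel _ (∑ i, φ (u i) * φ (x i)),
        ← Finset.sum_sub_distrib, key.2, Finset.sum_congr rfl fun i _ => hau' i, ← map_sum, ← map_sub,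
        ← map_add]
      simp [sub_mul]
    rw [LinearMap.mem_ker, LinearMap.comp_apply]
    exact (hψ a c).trans (by rw [this, ← map_add, h0, map_zero])
  obtain ⟨φ', hφ'⟩ := LinearMap.exists_comp_eq_of_ker_le _ _ hker
  have hval : ∀ (a : Fin m → R) (c : R), (∀ i, a i ∈ 𝓕.zterm (k + 1 - d i)) → c ∈ 𝓕.zterm k →
      φ' (∑ i, a i * x i + c) = ∑ i, φ (a i) * φ (x i) + φ c := fun a c ha hc => by
    rw [← hθ, ← hψ]
    exact LinearMap.congr_fun hφ' ⟨(a, c), by simpa [P] using ⟨ha, hc⟩⟩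
  have hagree : ∀ a ∈ 𝓕.zterm k, φ' a = φ a := fun a ha => by
    simpa using hval 0 a (fun i => zero_mem _) ha
  have hmul : ∀ {i j : ℤ} {a b : R}, i + j ≤ k → a ∈ 𝓕.zterm i → b ∈ 𝓕.zterm j →
      φ' (a * b) = φ' a * φ' b := by
    intro i j a b hij ha hb
    rcases lt_or_ge i 0 with hi | hi
    · rw [𝓕.zterm_of_neg hi, Submodule.mem_bot] at ha
      simp [ha]
    rcases lt_or_ge j 0 with hj | hj
    · rw [𝓕.zterm_of_neg hj, Submodule.mem_bot] at hb
      simp [hb]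
    rw [hagree _ (𝓕.mul_mem_zterm hij ha hb), hagree a (𝓕.zterm_mem_of_le (by omega) ha),
      hagree b (𝓕.zterm_mem_of_le (by omega) hb), hφ.map_mul hij ha hb]
  have hmul_pos : ∀ {i j : ℤ} {a b : R}, 1 ≤ j → i + j ≤ k + 1 → a ∈ 𝓕.zterm i →
      b ∈ 𝓕.zterm j → φ' (a * b) = φ' a * φ' b := by
    intro i j a b hj hij ha hb
    rcases lt_or_ge i 0 with hi | hi
    · rw [𝓕.zterm_of_neg hi, Submodule.mem_bot] at ha
      simp [ha]
    obtain ⟨c, hc, hcb⟩ := hgen j hj b hb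
    have hb' : b = ∑ l, c l * x l + (b - ∑ l, c l * x l) := by abel
    generalize b - ∑ l, c l * x l = b₀ at hcb hb'
    have hb₀ : b₀ ∈ 𝓕.zterm k := 𝓕.zterm_mem_of_le (by omega) hcb
    have hab : a * b = ∑ l, (a * c l) * x l + a * b₀ := by
      rw [hb', mul_add, Finset.mul_sum]
      simp [mul_assoc]
    rw [hab, hval _ _ (fun l => 𝓕.mul_mem_zterm (by omega) ha (hc l))
      (𝓕.mul_mem_zterm (by omega) ha hcb), hb',
      hval _ _ (fun l => 𝓕.zterm_mem_of_le (by omega) (hc l)) hb₀,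
      hagree a (𝓕.zterm_mem_of_le (by omega) ha), hφ.map_mul (by omega) ha hcb, mul_add,
      Finset.mul_sum]
    congr 1
    refine Finset.sum_congr rfl fun l _ => ?_
    have := hd' l
    rw [hφ.map_mul (by omega) ha (hc l), mul_assoc]
  refine ⟨φ', ⟨?_, ?_⟩, hagree⟩
  · rw [hagree 1 (𝓕.zterm_mem_of_le (by omega) 𝓕.one_mem_zterm), hφ.map_one]
  intro i j a b hij ha hb
  rcases le_or_gt 1 j with hj | hj
  · exact hmul_pos hj hij ha hb
  rcases le_or_gt 1 i with hi | hi
  swap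
  · rcases lt_or_ge i 0 with hi' | hi'
    · rw [𝓕.zterm_of_neg hi', Submodule.mem_bot] at ha
      simp [ha]
    · exact hmul (by omega) ha hb
  rcases lt_or_ge j 0 with hj' | hj'
  · rw [𝓕.zterm_of_neg hj', Submodule.mem_bot] at hb
    simp [hb]
  have hb : b ∈ 𝓕.zterm 0 := 𝓕.zterm_mem_of_le (by omega) hb
  rcases le_or_gt i k with hik | hik
  · exact hmul (by omega) ha hb
  -- In the remaining case `i = k + 1` and `b` has degree zero, so `a` is expanded instead and `b`
  -- is absorbed into `x l * b`.
  obtain ⟨c, hc, hca⟩ := hgen i hi a ha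
  have ha' : a = ∑ l, c l * x l + (a - ∑ l, c l * x l) := by abel
  generalize a - ∑ l, c l * x l = a₀ at hca ha'
  have hab : a * b = ∑ l, c l * (x l * b) + a₀ * b := by
    rw [ha', add_mul, Finset.sum_mul]
    simp [mul_assoc]
  rw [hab, ha', map_add, map_add, add_mul, map_sum, map_sum, Finset.sum_mul,
    hmul (i := i - 1) (by omega) hca hb]
  congr 1
  refine Finset.sum_congr rfl fun l _ => ?_
  have := hdk l
  rw [hmul_pos (hd' l) (by omega) (hc l) (𝓕.mul_mem_zterm (j := 0) (by omega) (hx l) hb),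
    hmul (j := 0) (by omega) (hx l) hb, hmul_pos (hd' l) (by omega) (hc l) (hx l), mul_assoc]

end FinDimFiltration

/-! ### Finite presentation -/

/-- The algebra with generators indexed by `X` and relations `W`. -/
abbrev PresentedAlgebra (F : Type*) [Field F] {X : Type*} (W : Set (FreeAlgebra F X)) : Type _ :=
  RingQuot fun a b : FreeAlgebra F X => a ∈ W ∧ b = 0

namespace PresentedAlgebra

variable {F : Type*} [Field F] {X : Type*} (W : Set (FreeAlgebra F X))

/-- The quotient map onto a presented algebra. -/
def mk : FreeAlgebra F X →ₐ[F] PresentedAlgebra F W := RingQuot.mkAlgHom F _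

theorem mk_eq_zero {a : FreeAlgebra F X} (ha : a ∈ W) : mk W a = 0 := by
  have h := RingQuot.mkAlgHom_rel F
    (s := fun a b : FreeAlgebra F X => a ∈ W ∧ b = 0) (x := a) (y := 0) ⟨ha, rfl⟩
  rwa [map_zero] at h

theorem nonempty_algEquiv {A : Type*} [Ring A] [Algebra F A] (π : FreeAlgebra F X →ₐ[F] A)
    (hπ : Function.Surjective π) (hW : ∀ w ∈ W, π w = 0) (hker : ∀ a, π a = 0 → mk W a = 0) :
    Nonempty (PresentedAlgebra F W ≃ₐ[F] A) := by
  let f : PresentedAlgebra F W →ₐ[F] A := RingQuot.liftAlgHom F ⟨π, fun a b h => by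
    rw [h.2, map_zero, hW a h.1]⟩
  have hf : ∀ a, f (mk W a) = π a := fun a => RingQuot.liftAlgHom_mkAlgHom_apply F π _ a
  refine ⟨AlgEquiv.ofBijective f ⟨(injective_iff_map_eq_zero f).2 fun b hb => ?_, fun a => ?_⟩⟩
  · obtain ⟨a, rfl⟩ := RingQuot.mkAlgHom_surjective F _ b
    exact hker a ((hf a).symm.trans hb)
  · obtain ⟨b, rfl⟩ := hπ a
    exact ⟨mk W b, hf b⟩

end PresentedAlgebra

namespace FinDimFiltration

variable {F R : Type*} [Field F] [Ring R] [Algebra F R] (𝓕 : FinDimFiltration F R)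

/-- An affine algebra with a filtration with left Noetherian associated graded ring is finitely
presented. -/
theorem exists_finite_presentation (hG : IsNoetherianRing 𝓕.gr) (hR : Algebra.FiniteType F R) :
    ∃ (n : ℕ) (W : Finset (FreeAlgebra F (Fin n))),
      Nonempty (PresentedAlgebra F (W : Set (FreeAlgebra F (Fin n))) ≃ₐ[F] R) := by
  classical
  obtain ⟨N₀, hN₀⟩ := 𝓕.exists_partialHom_succ hG
  obtain ⟨S, hS⟩ := hR.out
  choose lev hlev using 𝓕.exists_mem_zterm
  -- The level must allow extension of partial homomorphisms and contain algebra generators of `R`.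
  obtain ⟨N, hN, hSN⟩ : ∃ N : ℕ, N₀ ≤ N ∧ ∀ a ∈ S, a ∈ 𝓕.zterm N :=
    ⟨N₀ + ∑ a ∈ S, lev a, Nat.le_add_right _ _, fun a ha => 𝓕.zterm_mem_of_le (by
      exact_mod_cast (Finset.single_le_sum (fun _ _ => Nat.zero_le _) ha).trans
        (Nat.le_add_left _ N₀)) (hlev a)⟩
  have hfg : ∀ n : ℕ, ∃ s : Finset R, Submodule.span F (s : Set R) = 𝓕.term n := fun n => by
    have := 𝓕.finiteDimensional n
    exact (Submodule.fg_iff_finiteDimensional _).2 this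
  choose gen hgen using hfg
  have := 𝓕.finiteDimensional N
  let b := Module.finBasis F (𝓕.term N)
  let n := Module.finrank F (𝓕.term N)
  let π : FreeAlgebra F (Fin n) →ₐ[F] R := FreeAlgebra.lift F fun i => (b i : R)
  obtain ⟨s, hs⟩ := LinearMap.exists_extend
    (b.constr F fun i => FreeAlgebra.ι F (X := Fin n) i)
  have hsb : ∀ i, s (b i) = FreeAlgebra.ι F i := fun i => by
    have := LinearMap.congr_fun hs (b i)
    rwa [b.constr_basis] at this
  have hπs : ∀ a ∈ 𝓕.zterm N, π (s a) = a := by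
    have : π.toLinearMap ∘ₗ s ∘ₗ (𝓕.term N).subtype = (𝓕.term N).subtype :=
      b.ext fun i => by
        have h : π (s (b i)) = b i := by
          rw [hsb]
          exact FreeAlgebra.lift_ι_apply _ _
        exact h
    exact fun a ha => LinearMap.congr_fun this ⟨a, ha⟩
  have hπ : Function.Surjective π := by
    rw [← AlgHom.range_eq_top, eq_top_iff, ← hS, Algebra.adjoin_le_iff]
    exact fun a ha => ⟨s a, hπs a (hSN a ha)⟩
  -- The multiplication table of `𝓕_N`, imposed on finite spanning sets only; bilinearity gives the
  -- rest.
  let W : Finset (FreeAlgebra F (Fin n)) := insert (s 1 - 1)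
    (((Finset.range (N + 1) ×ˢ Finset.range (N + 1)).filter fun p => p.1 + p.2 ≤ N).biUnion
      fun p => (gen p.1 ×ˢ gen p.2).image fun q => s (q.1 * q.2) - s q.1 * s q.2)
  have hWmul : ∀ i j : ℕ, i + j ≤ N → ∀ a ∈ gen i, ∀ c ∈ gen j, s (a * c) - s a * s c ∈ W := by
    intro i j hij a ha c hc
    refine Finset.mem_insert_of_mem (Finset.mem_biUnion.2 ⟨(i, j), ?_, ?_⟩)
    · simp only [Finset.mem_filter, Finset.mem_product, Finset.mem_range]
      omega
    · exact Finset.mem_image.2 ⟨(a, c), Finset.mem_product.2 ⟨ha, hc⟩, rfl⟩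
  have hgen_mem : ∀ i, ∀ a ∈ gen i, a ∈ 𝓕.zterm i := fun i a ha => by
    rw [zterm_natCast, ← hgen]
    exact Submodule.subset_span ha
  have hone : (1 : R) ∈ 𝓕.zterm N := 𝓕.zterm_mem_of_le (by omega) 𝓕.one_mem_zterm
  refine ⟨n, W, PresentedAlgebra.nonempty_algEquiv _ π hπ ?_ ?_⟩
  · intro w hw
    rcases Finset.mem_insert.1 (Finset.mem_coe.1 hw) with rfl | hw
    · rw [map_sub, hπs 1 hone, map_one, sub_self]
    · obtain ⟨⟨i, j⟩, hij, hw⟩ := Finset.mem_biUnion.1 hw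
      obtain ⟨⟨a, c⟩, hac, rfl⟩ := Finset.mem_image.1 hw
      have hij := (Finset.mem_filter.1 hij).2
      obtain ⟨ha, hc⟩ := Finset.mem_product.1 hac
      have ha := hgen_mem i a ha
      have hc := hgen_mem j c hc
      simp only at hij ⊢
      rw [map_sub, map_mul π, hπs _ (𝓕.mul_mem_zterm (by omega) ha hc),
        hπs a (𝓕.zterm_mem_of_le (by omega) ha), hπs c (𝓕.zterm_mem_of_le (by omega) hc), sub_self]
  set β := PresentedAlgebra.mk (W : Set (FreeAlgebra F (Fin n))) with hβ
  have hβW : ∀ w ∈ W, β w = 0 := fun w hw => PresentedAlgebra.mk_eq_zero _ (Finset.mem_coe.2 hw)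
  let φ := β.toLinearMap ∘ₗ s
  have hφ : 𝓕.IsPartialHom N φ := by
    constructor
    · have := hβW _ (Finset.mem_insert_self _ _)
      rwa [map_sub, map_one β, sub_eq_zero] at this
    · intro i j a c hij ha hc
      rcases lt_or_ge i 0 with hi | hi
      · rw [𝓕.zterm_of_neg hi, Submodule.mem_bot] at ha
        simp [ha]
      rcases lt_or_ge j 0 with hj | hj
      · rw [𝓕.zterm_of_neg hj, Submodule.mem_bot] at hc
        simp [hc]
      lift i to ℕ using hi
      lift j to ℕ using hj
      rw [zterm_natCast, ← hgen] at ha hc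
      induction ha using Submodule.span_induction with
      | zero => simp
      | add x y _ _ hx hy => simp [add_mul, hx, hy]
      | smul r x _ hx => simp [hx]
      | mem a ha =>
        induction hc using Submodule.span_induction with
        | zero => simp
        | add x y _ _ hx hy => simp [mul_add, hx, hy]
        | smul r x _ hx => simp [hx]
        | mem c hc =>
          have := hβW _ (hWmul i j (by exact_mod_cast hij) a ha c hc)
          rwa [map_sub, map_mul β, sub_eq_zero] at this
  have hext : ∀ k : ℕ, ∃ φ' : R →ₗ[F] PresentedAlgebra F (W : Set (FreeAlgebra F (Fin n))),
      𝓕.IsPartialHom ((N + k : ℕ) : ℤ) φ' ∧ ∀ a ∈ 𝓕.zterm N, φ' a = φ a := by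
    intro k
    induction k with
    | zero => exact ⟨φ, hφ, fun _ _ => rfl⟩
    | succ k ih =>
      obtain ⟨φ₁, h₁, h₁'⟩ := ih
      obtain ⟨φ₂, h₂, h₂'⟩ := hN₀ (N + k) (by omega) φ₁ h₁
      refine ⟨φ₂, by exact_mod_cast h₂, fun a ha => ?_⟩
      rw [h₂' a (𝓕.zterm_mem_of_le (by omega) ha), h₁' a ha]
  -- For fixed `a`, one extension of sufficiently high level already recovers `β a` from `π a`, so
  -- extensions at different levels need not be compatible.
  have hdetect : ∀ a : FreeAlgebra F (Fin n), ∃ K : ℕ, π a ∈ 𝓕.zterm K ∧ ∀ k : ℕ, K ≤ N + k →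
      ∀ φ' : R →ₗ[F] PresentedAlgebra F (W : Set (FreeAlgebra F (Fin n))),
        𝓕.IsPartialHom ((N + k : ℕ) : ℤ) φ' → (∀ a ∈ 𝓕.zterm N, φ' a = φ a) →
          φ' (π a) = β a := by
    intro a
    induction a using FreeAlgebra.induction with
    | grade0 r =>
      refine ⟨0, ?_, fun k _ φ' h _ => ?_⟩
      · rw [AlgHom.commutes, Algebra.algebraMap_eq_smul_one]
        exact Submodule.smul_mem _ _ 𝓕.one_mem_zterm
      · rw [AlgHom.commutes, AlgHom.commutes, Algebra.algebraMap_eq_smul_one, map_smul,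
          h.map_one, ← Algebra.algebraMap_eq_smul_one]
    | grade1 i =>
      have hi : π (FreeAlgebra.ι F i) = b i := FreeAlgebra.lift_ι_apply _ _
      refine ⟨N, ?_, fun k _ φ' h h' => ?_⟩
      · rw [hi]
        exact (b i).2
      · rw [hi, h' _ (b i).2, ← hsb]
        rfl
    | mul a c ha hc =>
      obtain ⟨K, hK, hKφ⟩ := ha
      obtain ⟨K', hK', hKφ'⟩ := hc
      refine ⟨K + K', ?_, fun k hk φ' h h' => ?_⟩
      · rw [map_mul]
        exact 𝓕.mul_mem_zterm (by push_cast; rfl) hK hK'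
      · rw [map_mul π, map_mul β, h.map_mul (by exact_mod_cast hk) hK hK',
          hKφ k (by omega) φ' h h', hKφ' k (by omega) φ' h h']
    | add a c ha hc =>
      obtain ⟨K, hK, hKφ⟩ := ha
      obtain ⟨K', hK', hKφ'⟩ := hc
      refine ⟨K + K', ?_, fun k hk φ' h h' => ?_⟩
      · rw [map_add]
        exact add_mem (𝓕.zterm_mem_of_le (by omega) hK) (𝓕.zterm_mem_of_le (by omega) hK')
      · rw [map_add, map_add, map_add, hKφ k (by omega) φ' h h', hKφ' k (by omega) φ' h h']
  intro a ha
  obtain ⟨K, -, hK⟩ := hdetect a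
  obtain ⟨φ', h, h'⟩ := hext K
  rw [← hK K (by omega) φ' h h', ha, map_zero]

end FinDimFiltration

/-! ### Counting isomorphism classes -/

theorem countable_freeAlgebra (F : Type*) [Field F] [Countable F] (X : Type*) [Countable X] :
    Countable (FreeAlgebra F X) := by
  rw [← Cardinal.mk_le_aleph0_iff]
  refine (FreeAlgebra.cardinalMk_le_max_lift F X).trans ?_
  simp [Cardinal.mk_le_aleph0]

/-- Over a countable field there are at most countably many affine algebras that admit a
Noetherian filtration. -/
theorem countable_isoClasses_hasNoetherianFiltration (F : Type) [Field F] [Countable F] :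
    (isoClasses F fun A => Algebra.FiniteType F A ∧ HasNoetherianFiltration F A).Countable := by
  have := fun n : ℕ => countable_freeAlgebra F (Fin n)
  refine (Set.countable_range fun p : Σ n : ℕ, Finset (FreeAlgebra F (Fin n)) =>
    Quotient.mk (algIsoSetoid F)
      (AlgCat.of F (PresentedAlgebra F (p.2 : Set (FreeAlgebra F (Fin p.1)))))).mono ?_
  rintro _ ⟨A, ⟨hA, 𝓕, h𝓕⟩, rfl⟩
  obtain ⟨n, W, h⟩ := 𝓕.exists_finite_presentation h𝓕.1 hA
  exact ⟨⟨n, W⟩, Quotient.sound h⟩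

/-- Over a countable field there are at most continuum many affine algebras. -/
theorem mk_isoClasses_finiteType_le (F : Type) [Field F] [Countable F]
    (P : AlgCat.{0} F → Prop) (hP : ∀ A, P A → Algebra.FiniteType F A) :
    Cardinal.mk (isoClasses F P) ≤ Cardinal.continuum := by
  have := fun n : ℕ => countable_freeAlgebra F (Fin n)
  let f : (Σ n : ℕ, Set (FreeAlgebra F (Fin n))) → Quotient (algIsoSetoid F) := fun p =>
    Quotient.mk (algIsoSetoid F) (AlgCat.of F (PresentedAlgebra F p.2))
  have hsub : isoClasses F P ⊆ Set.range f := by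
    rintro _ ⟨A, hA, rfl⟩
    obtain ⟨ι, _, π', hπ'⟩ := Algebra.FiniteType.iff_quotient_freeAlgebra'.1 (hP A hA)
    let e := Fintype.equivFin ι
    let π : FreeAlgebra F (Fin (Fintype.card ι)) →ₐ[F] A :=
      FreeAlgebra.lift F fun i => π' (FreeAlgebra.ι F (e.symm i))
    have hπ : Function.Surjective π := by
      have h : π.comp (FreeAlgebra.lift F fun i => FreeAlgebra.ι F (e i)) = π' := by
        ext i
        simp [π]
      intro a
      obtain ⟨b, rfl⟩ := hπ' a
      exact ⟨_, DFunLike.congr_fun h b⟩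
    refine ⟨⟨Fintype.card ι, {a | π a = 0}⟩, Quotient.sound (PresentedAlgebra.nonempty_algEquiv _ π hπ
      (fun _ h => h) fun a ha => PresentedAlgebra.mk_eq_zero _ ha)⟩
  refine (Cardinal.mk_le_mk_of_subset hsub).trans ?_
  have h := Cardinal.mk_range_le_lift (f := f)
  rw [Cardinal.lift_id'] at h
  refine h.trans ?_
  -- The isomorphism classes live in `Type 1`, the sets of relations in `Type`; hence the lift.
  rw [← Cardinal.lift_continuum.{1, 0}, Cardinal.lift_le, Cardinal.mk_sigma]
  refine (Cardinal.sum_le_sum _ (fun _ => Cardinal.continuum) fun n => ?_).trans ?_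
  · rw [Cardinal.mk_set, ← Cardinal.two_power_aleph0]
    exact Cardinal.power_le_power_left two_ne_zero Cardinal.mk_le_aleph0
  · simp

/-! ### The Ore extension `K[x; δ]` as operators on `K[X]` -/

namespace OreExtension

open Polynomial

variable {F K : Type*} [Field F] [Field K] [Algebra F K] (δ : Derivation F K K)

theorem coeff_sum_monomial (p : K[X]) (n : ℕ) :
    (p.sum fun n a => monomial n (δ a)).coeff n = δ (p.coeff n) := by
  rw [Polynomial.sum_def, finsetSum_coeff]
  simp only [coeff_monomial, Finset.sum_ite_eq', mem_support_iff, ne_eq]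
  split_ifs with h
  · rfl
  · rw [notMem_support_iff.1 h, map_zero]

/-- The coefficientwise action of a derivation on polynomials. -/
noncomputable def mapCoeff : K[X] →ₗ[F] K[X] where
  toFun p := p.sum fun n a => monomial n (δ a)
  map_add' p q := by
    ext n
    simp only [coeff_sum_monomial, coeff_add, map_add]
  map_smul' c p := by
    ext n
    simp only [coeff_sum_monomial, coeff_smul, RingHom.id_apply]
    exact δ.map_smul c _

theorem coeff_mapCoeff (p : K[X]) (n : ℕ) : (mapCoeff δ p).coeff n = δ (p.coeff n) :=
  coeff_sum_monomial δ p n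

/-- The action of the variable of `K[x; δ]` on `K[x; δ]`, identified with `K[X]` as a left
`K`-space. -/
noncomputable def var : Module.End F K[X] := LinearMap.mulLeft F X + mapCoeff δ

theorem var_apply (p : K[X]) : var δ p = X * p + mapCoeff δ p := rfl

variable (F) in
/-- The action of the constants of `K[x; δ]` on `K[X]`. -/
noncomputable def const : K →ₐ[F] Module.End F K[X] :=
  (Algebra.lmul F K[X]).comp (IsScalarTower.toAlgHom F K K[X])

theorem const_apply (a : K) (p : K[X]) : const F a p = C a * p := rfl

/-- The Ore relation `x a = a x + δ a`, which is the Leibniz rule applied coefficientwise. -/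
theorem var_mul_const (a : K) : var δ * const F a = const F a * var δ + const F (δ a) := by
  ext p : 1
  simp only [Module.End.mul_apply, LinearMap.add_apply, const_apply, var_apply]
  have : mapCoeff δ (C a * p) = C a * mapCoeff δ p + C (δ a) * p := by
    ext n
    simp [coeff_mapCoeff, mul_comm]
  rw [this]
  ring

/-- The operator `∑ aᵢ xⁱ` of left multiplication by an element of `K[x; δ]`. -/
noncomputable def op (f : K[X]) : Module.End F K[X] :=
  eval₂ (const F : K →ₐ[F] _).toRingHom (var δ) f

theorem op_add (f g : K[X]) : op δ (f + g) = op δ f + op δ g := eval₂_add _ _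

theorem op_monomial (n : ℕ) (a : K) : op δ (monomial n a) = const F a * var δ ^ n :=
  eval₂_monomial _ _

theorem op_one : op δ 1 = 1 := eval₂_one _ _

theorem op_C_mul (a : K) (f : K[X]) : op δ (C a * f) = const F a * op δ f := by
  induction f using Polynomial.induction_on' with
  | add p q hp hq => rw [mul_add, op_add, op_add, mul_add, hp, hq]
  | monomial n b => rw [C_mul_monomial, op_monomial, op_monomial, map_mul, mul_assoc]

theorem op_var_apply (f : K[X]) : op δ (var δ f) = var δ * op δ f := by
  induction f using Polynomial.induction_on' with
  | add p q hp hq => rw [map_add, op_add, op_add, mul_add, hp, hq]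
  | monomial n b =>
    have h : var δ (monomial n b) = monomial (n + 1) b + monomial n (δ b) := by
      rw [var_apply, X_mul_monomial]
      congr 1
      ext k
      rw [coeff_mapCoeff, coeff_monomial, coeff_monomial]
      split_ifs <;> simp
    rw [h, op_add, op_monomial, op_monomial, op_monomial, ← mul_assoc, var_mul_const, add_mul,
      pow_succ', mul_assoc]

/-- Multiplication by `X` raises the degree by one and keeps the top coefficient, while `mapCoeff δ`
does not raise the degree. -/
theorem coeff_var_pow_apply {n : ℕ} {g : K[X]} (hg : g.natDegree ≤ n) (i : ℕ) :
    (∀ k, n + i < k → ((var δ ^ i) g).coeff k = 0) ∧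
      ((var δ ^ i) g).coeff (n + i) = g.coeff n := by
  induction i with
  | zero => exact ⟨fun k hk => coeff_eq_zero_of_natDegree_lt (hg.trans_lt hk), rfl⟩
  | succ i ih =>
    have hstep : ∀ k, ((var δ ^ (i + 1)) g).coeff (k + 1) =
        ((var δ ^ i) g).coeff k + δ (((var δ ^ i) g).coeff (k + 1)) := fun k => by
      rw [pow_succ', Module.End.mul_apply, var_apply, coeff_add, coeff_X_mul, coeff_mapCoeff]
    refine ⟨fun k hk => ?_, ?_⟩
    · obtain ⟨k, rfl⟩ : ∃ l, k = l + 1 := ⟨k - 1, by omega⟩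
      rw [hstep, ih.1 k (by omega), ih.1 (k + 1) (by omega), map_zero, add_zero]
    · rw [← add_assoc, hstep, ih.2, ih.1 _ (by omega), map_zero, add_zero]

/-- Leading terms multiply in `K[x; δ]`. -/
theorem coeff_op_apply {m n : ℕ} {f g : K[X]} (hf : f.natDegree ≤ m) (hg : g.natDegree ≤ n) :
    (∀ k, m + n < k → (op δ f g).coeff k = 0) ∧
      (op δ f g).coeff (m + n) = f.coeff m * g.coeff n := by
  have h : ∀ k, (op δ f g).coeff k =
      ∑ i ∈ Finset.range (m + 1), f.coeff i * ((var δ ^ i) g).coeff k := fun k => by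
    rw [op, eval₂_eq_sum_range' _ (Nat.lt_succ_of_le hf), LinearMap.sum_apply, finsetSum_coeff]
    refine Finset.sum_congr rfl fun i _ => ?_
    exact coeff_C_mul _
  refine ⟨fun k hk => ?_, ?_⟩
  · rw [h]
    refine Finset.sum_eq_zero fun i hi => ?_
    rw [Finset.mem_range] at hi
    rw [(coeff_var_pow_apply δ hg i).1 k (by omega), mul_zero]
  · rw [h, Finset.sum_eq_single m]
    · rw [add_comm, (coeff_var_pow_apply δ hg m).2]
    · intro i hi him
      rw [Finset.mem_range] at hi
      rw [(coeff_var_pow_apply δ hg i).1 _ (by omega), mul_zero]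
    · simp

theorem op_apply_one (f : K[X]) : op δ f 1 = f := by
  have hv : ∀ i, (var δ ^ i) 1 = (X ^ i : K[X]) := fun i => by
    induction i with
    | zero => rfl
    | succ i ih =>
      have : mapCoeff δ (X ^ i) = 0 := by
        ext k
        rw [coeff_mapCoeff, coeff_X_pow]
        split_ifs <;> simp
      rw [pow_succ', Module.End.mul_apply, ih, var_apply, this, add_zero, pow_succ']
  induction f using Polynomial.induction_on' with
  | add p q hp hq => rw [op_add, LinearMap.add_apply, hp, hq]
  | monomial n a =>
    rw [op_monomial, Module.End.mul_apply, hv, const_apply, C_mul_X_pow_eq_monomial]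

/-- The algebra of operators on `K[X]` generated by the variable of `K[x; δ]` and a set of
constants. -/
noncomputable def alg (s : Set K) : Subalgebra F (Module.End F K[X]) :=
  Algebra.adjoin F (insert (var δ) (const F '' s))

variable {δ}

/-- Both kinds of generators satisfy `T * op δ f = op δ (T f)`, a property stable under sums and
products; take `f = 1`. Evaluation at `1` thus identifies an operator with its polynomial, and
degrees become available. -/
theorem eq_op_of_mem_alg {s : Set K} {T : Module.End F K[X]} (hT : T ∈ alg δ s) :
    T = op δ (T 1) := by
  have key : ∀ f : K[X], T * op δ f = op δ (T f) := by
    induction hT using Algebra.adjoin_induction with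
    | mem T hT =>
      rcases hT with rfl | ⟨a, -, rfl⟩
      · exact fun f => (op_var_apply δ f).symm
      · exact fun f => (op_C_mul δ a f).symm
    | algebraMap r =>
      intro f
      rw [← (const F : K →ₐ[F] _).commutes, const_apply, op_C_mul]
    | add T U _ _ hT hU =>
      intro f
      rw [add_mul, hT, hU, LinearMap.add_apply, op_add]
    | mul T U _ _ hT hU =>
      intro f
      rw [mul_assoc, hU, hT, Module.End.mul_apply]
  rw [← key, op_one, mul_one]

theorem op_mem_alg {s : Set K} (hs : ∀ a, const F a ∈ alg δ s) (f : K[X]) : op δ f ∈ alg δ s := by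
  induction f using Polynomial.induction_on' with
  | add p q hp hq =>
    rw [op_add]
    exact add_mem hp hq
  | monomial n a =>
    rw [op_monomial]
    exact mul_mem (hs a) (pow_mem (Algebra.subset_adjoin (Set.mem_insert _ _)) n)

theorem mul_apply_one {s : Set K} {T U : Module.End F K[X]} (hT : T ∈ alg δ s) :
    (T * U) 1 = op δ (T 1) (U 1) := by
  rw [Module.End.mul_apply]
  exact LinearMap.congr_fun (eq_op_of_mem_alg hT) _

theorem eq_zero_of_apply_one {s : Set K} {T : Module.End F K[X]} (hT : T ∈ alg δ s)
    (h : T 1 = 0) : T = 0 := by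
  rw [eq_op_of_mem_alg hT, h]
  exact eval₂_zero _ _

end OreExtension

/-! ### Division with remainder and square roots of scalars -/

/-- A ring with a left division algorithm is left Noetherian. -/
theorem isNoetherianRing_of_division {A : Type*} [Ring A] (d : A → ℕ)
    (h : ∀ f g : A, f ≠ 0 → g ≠ 0 → d g ≤ d f → ∃ q, f - q * g = 0 ∨ d (f - q * g) < d f) :
    IsNoetherianRing A := by
  refine ⟨fun I => ?_⟩
  by_cases hI : I = ⊥
  · rw [hI]
    exact Submodule.fg_bot
  -- A nonzero element of least degree generates the left ideal.
  obtain ⟨g, ⟨hgI, hg0⟩, hmin⟩ : ∃ g ∈ {g | g ∈ I ∧ g ≠ 0}, ∀ f ∈ {g | g ∈ I ∧ g ≠ 0},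
      d g ≤ d f := by
    obtain ⟨x, hx⟩ := Submodule.exists_mem_ne_zero_of_ne_bot hI
    obtain ⟨g, hg, hmin⟩ := (measure d).wf.has_min {g | g ∈ I ∧ g ≠ 0} ⟨x, hx⟩
    exact ⟨g, hg, fun f hf => not_lt.1 (hmin f hf)⟩
  refine ⟨{g}, le_antisymm (Submodule.span_le.2 (by simpa using hgI)) fun f hf => ?_⟩
  rw [Finset.coe_singleton, Submodule.mem_span_singleton]
  induction hn : d f using Nat.strong_induction_on generalizing f with
  | _ n ih =>
    subst hn
    by_cases hf0 : f = 0
    · exact ⟨0, by rw [hf0, zero_smul]⟩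
    obtain ⟨q, hq⟩ := h f g hf0 hg0 (hmin f ⟨hf, hf0⟩)
    rcases hq with hq | hq
    · exact ⟨q, (sub_eq_zero.1 hq).symm⟩
    · obtain ⟨c, hc⟩ := ih _ hq _ (sub_mem hf (I.smul_mem q hgI)) rfl
      refine ⟨c + q, ?_⟩
      rw [add_smul, hc, smul_eq_mul, sub_add_cancel]

namespace OreExtension

open Polynomial

variable {F K : Type*} [Field F] [Field K] [Algebra F K] {δ : Derivation F K K}

theorem sub_eq_zero_or_natDegree_lt {f r : K[X]} (hr : ∀ k, f.natDegree < k → r.coeff k = 0)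
    (hr' : r.coeff f.natDegree = f.coeff f.natDegree) :
    f - r = 0 ∨ (f - r).natDegree < f.natDegree := by
  by_cases h : f - r = 0
  · exact Or.inl h
  refine Or.inr (lt_of_not_ge fun hle => h ?_)
  rw [← leadingCoeff_eq_zero, leadingCoeff, coeff_sub]
  rcases hle.eq_or_lt with heq | hlt
  · rw [← heq, hr', sub_self]
  · rw [hr _ hlt, coeff_eq_zero_of_natDegree_lt hlt, sub_self]

/-- Leading coefficients multiply in the commutative field `K` without a twist, so the same monomial
quotient serves on both sides. -/
theorem exists_division {f g : K[X]} (hg : g ≠ 0) (hfg : g.natDegree ≤ f.natDegree) :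
    ∃ q : K[X], (f - op δ q g = 0 ∨ (f - op δ q g).natDegree < f.natDegree) ∧
      (f - op δ g q = 0 ∨ (f - op δ g q).natDegree < f.natDegree) := by
  have hlc : g.coeff g.natDegree ≠ 0 := leadingCoeff_ne_zero.2 hg
  have hq := natDegree_monomial_le (m := f.natDegree - g.natDegree)
    (f.coeff f.natDegree / g.coeff g.natDegree)
  refine ⟨monomial (f.natDegree - g.natDegree) (f.coeff f.natDegree / g.coeff g.natDegree),
    ?_, ?_⟩
  · have h := coeff_op_apply δ hq (le_refl g.natDegree)
    rw [Nat.sub_add_cancel hfg, coeff_monomial_same, div_mul_cancel₀ _ hlc] at h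
    exact sub_eq_zero_or_natDegree_lt h.1 h.2
  · have h := coeff_op_apply δ (le_refl g.natDegree) hq
    rw [Nat.add_sub_cancel' hfg, coeff_monomial_same, mul_div_cancel₀ _ hlc] at h
    exact sub_eq_zero_or_natDegree_lt h.1 h.2

theorem isTwoSidedNoetherian_alg {s : Set K} (hs : ∀ a, const F a ∈ alg δ s) :
    IsTwoSidedNoetherian (alg δ s) := by
  have h0 : ∀ T : alg δ s, T ≠ 0 → T.1 1 ≠ 0 := fun T hT h =>
    hT (Subtype.ext (eq_zero_of_apply_one T.2 h))
  constructor
  · refine isNoetherianRing_of_division (fun T => (T.1 1).natDegree) fun f g _ hg hfg => ?_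
    obtain ⟨q, hq, -⟩ := exists_division (δ := δ) (h0 g hg) hfg
    have hval : (f - ⟨op δ q, op_mem_alg hs q⟩ * g).1 1 = f.1 1 - op δ q (g.1 1) := rfl
    refine ⟨⟨op δ q, op_mem_alg hs q⟩, hq.imp (fun h => ?_) fun h => ?_⟩
    · exact Subtype.ext (eq_zero_of_apply_one (Subtype.prop _) (hval.trans h))
    · rwa [hval]
  · refine isNoetherianRing_of_division (fun T : (alg δ s)ᵐᵒᵖ => (T.unop.1 1).natDegree) fun f g _ hg hfg => ?_
    obtain ⟨q, -, hq⟩ := exists_division (δ := δ) (h0 g.unop (by simpa using hg)) hfg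
    have hval : (f - MulOpposite.op (⟨op δ q, op_mem_alg hs q⟩ : alg δ s) * g).unop.1 1 =
        f.unop.1 1 - op δ (g.unop.1 1) q := by
      have : (g.unop.1 * op δ q) 1 = op δ (g.unop.1 1) q := by
        rw [mul_apply_one g.unop.2, op_apply_one]
      rw [← this]
      rfl
    refine ⟨MulOpposite.op (⟨op δ q, op_mem_alg hs q⟩ : alg δ s), hq.imp (fun h => ?_) fun h => ?_⟩
    · refine MulOpposite.unop_injective (Subtype.ext ?_)
      exact eq_zero_of_apply_one (Subtype.prop _) (hval.trans h)
    · rwa [hval]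

/-- Square roots of scalars in `K[x; δ]` are constants. -/
theorem exists_mul_self_eq {s : Set K} {c : F}
    (h : ∃ u : alg δ s, u * u = algebraMap F (alg δ s) c) : ∃ a : K, a * a = algebraMap F K c := by
  obtain ⟨u, hu⟩ := h
  have h1 : op δ (u.1 1) (u.1 1) = C (algebraMap F K c) := by
    have hu1 : (u.1 * u.1) 1 = (algebraMap F (Module.End F K[X]) c) 1 := by
      have := congrArg (fun T : alg δ s => T.1 1) hu
      exact this
    rw [← mul_apply_one u.2, hu1, ← (const F : K →ₐ[F] _).commutes, const_apply, mul_one]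
  -- The top coefficient of `u * u` is the square of that of `u`, so a scalar value forces degree
  -- zero.
  have h2 := (coeff_op_apply δ (le_refl (u.1 1).natDegree) (le_refl (u.1 1).natDegree)).2
  rw [h1, coeff_C] at h2
  split_ifs at h2 with hn
  · exact ⟨_, h2.symm⟩
  · have : (u.1 1).leadingCoeff = 0 := mul_self_eq_zero.1 h2.symm
    rw [leadingCoeff_eq_zero.1 this] at hn
    simp at hn

end OreExtension

/-! ### Derivations of fields -/

/-- A derivation of a domain with values in its fraction field extends to the fraction field. -/
theorem Derivation.exists_extend_fractionField {A L : Type*} [CommRing A] [Field L] [Algebra A L]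
    [IsFractionRing A L] (D : Derivation ℤ A L) :
    ∃ D' : Derivation ℤ L L, ∀ a, D' (algebraMap A L a) = D a := by
  -- The Leibniz rule says that `a ↦ a + ε D a` is multiplicative. Denominators become units,
  -- because a dual number is a unit when its first component is, so the map extends to `L`.
  let φ : A →+* DualNumber L :=
    { toFun := fun a => TrivSqZeroExt.inl (algebraMap A L a) + TrivSqZeroExt.inr (D a)
      map_one' := by ext <;> simp
      map_zero' := by ext <;> simp
      map_add' := fun a b => by ext <;> simp
      map_mul' := fun a b => by
        ext
        · simp
        · simp only [TrivSqZeroExt.snd_mul, TrivSqZeroExt.snd_add, TrivSqZeroExt.snd_inl,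
            TrivSqZeroExt.snd_inr, TrivSqZeroExt.fst_add, TrivSqZeroExt.fst_inl,
            TrivSqZeroExt.fst_inr, add_zero, zero_add, D.leibniz, op_smul_eq_smul,
            algebraMap_smul] }
  have hfst : ∀ a, (φ a).fst = algebraMap A L a := fun a => by simp [φ]
  have hsnd : ∀ a, (φ a).snd = D a := fun a => by simp [φ]
  have hunit : ∀ y : nonZeroDivisors A, IsUnit (φ y) := fun y => by
    rw [TrivSqZeroExt.isUnit_iff_isUnit_fst, hfst]
    exact IsLocalization.map_units L y
  let Φ : L →+* DualNumber L := IsLocalization.lift hunit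
  have hΦ : ∀ a, Φ (algebraMap A L a) = φ a := fun a => IsLocalization.lift_eq hunit a
  have hΦfst : ∀ x, (Φ x).fst = x := by
    have : ((TrivSqZeroExt.fstHom L L L).toRingHom.comp Φ) = RingHom.id L :=
      IsLocalization.ringHom_ext (nonZeroDivisors A) (RingHom.ext fun a =>
        (congrArg TrivSqZeroExt.fst (hΦ a)).trans (hfst a))
    exact fun x => RingHom.congr_fun this x
  refine ⟨Derivation.mk' (AddMonoidHom.toIntLinearMap
    { toFun := fun x => (Φ x).snd
      map_zero' := by simp
      map_add' := fun x y => by simp }) fun x y => ?_, fun a => ?_⟩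
  · change (Φ (x * y)).snd = x • (Φ y).snd + y • (Φ x).snd
    rw [map_mul, TrivSqZeroExt.snd_mul, hΦfst, hΦfst, op_smul_eq_smul]
  · exact (congrArg TrivSqZeroExt.snd (hΦ a)).trans (hsnd a)

namespace IntermediateField

variable {F L : Type*} [Field F] [Field L] [Algebra F L] (E : Derivation F L L)

theorem derivation_mem_adjoin {S : Set L} (h : ∀ x ∈ S, E x ∈ adjoin F S) :
    ∀ x ∈ adjoin F S, E x ∈ adjoin F S := by
  intro x hx
  induction hx using adjoin_induction with
  | mem x hx => exact h x hx
  | algebraMap c =>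
    rw [E.map_algebraMap]
    exact zero_mem _
  | add x y _ _ hx hy =>
    rw [map_add]
    exact add_mem hx hy
  | inv x hx0 hx =>
    rw [E.leibniz_inv]
    rw [neg_smul, smul_eq_mul]
    exact neg_mem (mul_mem (pow_mem (inv_mem hx0) 2) hx)
  | mul x y hx0 hy0 hx hy =>
    rw [E.leibniz]
    exact add_mem (mul_mem hx0 hy) (mul_mem hy0 hx)

theorem derivation_eq_zero_of_mem_adjoin {S : Set L} (h : ∀ x ∈ S, E x = 0) :
    ∀ x ∈ adjoin F S, E x = 0 := by
  intro x hx
  induction hx using adjoin_induction with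
  | mem x hx => exact h x hx
  | algebraMap c => exact E.map_algebraMap c
  | add x y _ _ hx hy => rw [map_add, hx, hy, add_zero]
  | inv x _ hx => rw [E.leibniz_inv, hx, smul_zero]
  | mul x y _ _ hx hy => rw [E.leibniz, hx, hy, smul_zero, smul_zero, add_zero]

/-- The restriction of a derivation to an intermediate field that it preserves. -/
def restrictDerivation (K : IntermediateField F L) (h : ∀ x ∈ K, E x ∈ K) : Derivation F K K :=
  Derivation.mk'
    { toFun := fun x => ⟨E x, h x x.2⟩
      map_add' := fun x y => Subtype.ext (map_add E (x : L) y)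
      map_smul' := fun c x => Subtype.ext (E.map_smul c (x : L)) }
    fun x y => Subtype.ext (E.leibniz (x : L) y)

end IntermediateField

/-! ### Square-root systems and the family of Ore extensions -/

/-- A family of elements of `L` indexed by `ℕ × Bool` on which `F`-derivations take arbitrary values,
where `F` contains all squares of `L` and square roots in `L` are unique. -/
structure SquareRootSystem (F L : Type*) [Field F] [Field L] [Algebra F L] where
  /-- the members of the family -/
  gen : ℕ × Bool → L
  exists_derivation : ∀ v : ℕ × Bool → L, ∃ E : Derivation F L L, ∀ p, E (gen p) = v p
  sq : L → F
  algebraMap_sq : ∀ x, algebraMap F L (sq x) = x * x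
  eq_of_mul_self_eq : ∀ x y : L, x * x = y * y → x = y

namespace SquareRootSystem

/-- In characteristic 2 every derivation kills squares, hence is linear over the subfield of
squares; injectivity of Frobenius makes square roots unique. -/
theorem exists_over_frobenius_range {L : Type*} [Field L] [CharP L 2] (gen : ℕ × Bool → L)
    (h : ∀ v : ℕ × Bool → L, ∃ D : Derivation ℤ L L, ∀ p, D (gen p) = v p) :
    Nonempty (SquareRootSystem (frobenius L 2).fieldRange L) := by
  refine ⟨gen, fun v => ?_, fun x => ⟨x * x, x, by rw [frobenius_def, pow_two]⟩, fun x => rfl,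
    fun x y hxy => frobenius_inj L 2 (by
      rw [frobenius_def, frobenius_def, pow_two, pow_two, hxy])⟩
  obtain ⟨D, hD⟩ := h v
  have hsq : ∀ c : (frobenius L 2).fieldRange, D c = 0 := by
    rintro ⟨_, x, rfl⟩
    change D (x ^ 2) = 0
    rw [D.leibniz_pow, ← Nat.cast_smul_eq_nsmul L, CharP.cast_eq_zero, zero_smul]
  refine ⟨Derivation.mk'
    { toFun := D
      map_add' := map_add D
      map_smul' := fun c x => ?_ } fun x y => D.leibniz x y, hD⟩
  rw [Subfield.smul_def, smul_eq_mul, D.leibniz, hsq, smul_zero, add_zero]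
  rfl

/-- The rational function field in countably many variables over `𝔽₂`, over its squares. -/
theorem exists_countable : ∃ (F L : Type) (_ : Field F) (_ : Field L) (_ : Algebra F L),
    Countable F ∧ Nonempty (SquareRootSystem F L) := by
  let A := MvPolynomial (ℕ × Bool) (ZMod 2)
  let L := FractionRing A
  have : CharP L 2 := charP_of_injective_algebraMap (IsFractionRing.injective A L) 2
  have : Countable L := by
    rw [← Cardinal.mk_le_aleph0_iff, Cardinal.mk_fractionRing]
    refine MvPolynomial.cardinalMk_le_max.trans ?_
    simp
  refine ⟨(frobenius L 2).fieldRange, L, inferInstance, inferInstance, inferInstance,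
    inferInstance, exists_over_frobenius_range
      (fun p => algebraMap A L (MvPolynomial.X p)) fun v => ?_⟩
  let D₀ : Derivation (ZMod 2) A L := MvPolynomial.mkDerivation (ZMod 2) v
  let D₁ : Derivation ℤ A L := Derivation.mk' (D₀ : A →+ L).toIntLinearMap D₀.leibniz
  obtain ⟨D, hD⟩ := D₁.exists_extend_fractionField
  exact ⟨D, fun p => (hD _).trans (MvPolynomial.mkDerivation_X _ _ _)⟩

variable {F L : Type*} [Field F] [Field L] [Algebra F L] (S : SquareRootSystem F L)

/-- The field generated over `F` by one element `gen (n, A n)` for each `n`. -/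
abbrev tower (A : ℕ → Bool) : IntermediateField F L :=
  IntermediateField.adjoin F (Set.range fun n => S.gen (n, A n))

theorem gen_mem_tower (A : ℕ → Bool) (n : ℕ) : S.gen (n, A n) ∈ S.tower A :=
  IntermediateField.subset_adjoin _ _ ⟨n, rfl⟩

/-- The distinguished generators of the tower. -/
def towerGen (A : ℕ → Bool) (n : ℕ) : S.tower A := ⟨_, S.gen_mem_tower A n⟩

/-- If `A n ≠ b`, the derivation that is `1` at `gen (n, b)` and `0` at the other generators
vanishes on the tower. -/
theorem gen_mem_tower_iff {A : ℕ → Bool} {n : ℕ} {b : Bool} :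
    S.gen (n, b) ∈ S.tower A ↔ A n = b := by
  refine ⟨fun h => ?_, fun h => h ▸ S.gen_mem_tower A n⟩
  by_contra hne
  obtain ⟨E, hE⟩ := S.exists_derivation (Pi.single (n, b) 1)
  have h0 := IntermediateField.derivation_eq_zero_of_mem_adjoin E (by
    rintro _ ⟨m, rfl⟩
    refine (hE _).trans (Pi.single_eq_of_ne ?_ _)
    rintro ⟨⟩
    exact hne rfl) _ h
  rw [hE, Pi.single_eq_same] at h0
  exact one_ne_zero h0

theorem exists_tower_derivation (A : ℕ → Bool) : ∃ δ : Derivation F (S.tower A) (S.tower A),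
    ∀ n, δ (S.towerGen A n) = S.towerGen A (n + 1) := by
  obtain ⟨E, hE⟩ := S.exists_derivation fun p => S.gen (p.1 + 1, A (p.1 + 1))
  refine ⟨IntermediateField.restrictDerivation E _
    (IntermediateField.derivation_mem_adjoin E ?_), fun n => Subtype.ext (hE _)⟩
  rintro _ ⟨m, rfl⟩
  simp only [hE]
  exact S.gen_mem_tower A (m + 1)

/-- The derivation of the tower that shifts the distinguished generators. -/
noncomputable def shift (A : ℕ → Bool) : Derivation F (S.tower A) (S.tower A) :=
  (S.exists_tower_derivation A).choose

theorem shift_towerGen (A : ℕ → Bool) (n : ℕ) :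
    S.shift A (S.towerGen A n) = S.towerGen A (n + 1) :=
  (S.exists_tower_derivation A).choose_spec n

/-- The Ore extension of the tower by the shift derivation. -/
noncomputable abbrev oreAlgebra (A : ℕ → Bool) :
    Subalgebra F (Module.End F (Polynomial (S.tower A))) :=
  OreExtension.alg (S.shift A) {S.towerGen A 0}

theorem finiteType_oreAlgebra (A : ℕ → Bool) : Algebra.FiniteType F (S.oreAlgebra A) := by
  rw [← Subalgebra.fg_iff_finiteType]
  exact Subalgebra.fg_def.2 ⟨_, by simp, rfl⟩

/-- Commutators with the variable turn `towerGen A n` into `towerGen A (n + 1)`, so one generator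
yields all. Inverses come for free from `x⁻¹ = (x²)⁻¹ x` with `x²` a scalar. -/
theorem const_mem_oreAlgebra (A : ℕ → Bool) (a : S.tower A) :
    OreExtension.const F a ∈ S.oreAlgebra A := by
  have hgen : ∀ n, OreExtension.const F (S.towerGen A n) ∈ S.oreAlgebra A := by
    intro n
    induction n with
    | zero => exact Algebra.subset_adjoin (Set.mem_insert_of_mem _ ⟨_, rfl, rfl⟩)
    | succ n ih =>
      have hvar : OreExtension.var (S.shift A) ∈ S.oreAlgebra A :=
        Algebra.subset_adjoin (Set.mem_insert _ _)
      have h := OreExtension.var_mul_const (S.shift A) (S.towerGen A n)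
      rw [shift_towerGen, ← sub_eq_iff_eq_add'] at h
      rw [← h]
      exact sub_mem (mul_mem hvar ih) (mul_mem ih hvar)
  obtain ⟨a, ha⟩ := a
  induction ha using IntermediateField.adjoin_induction with
  | mem x hx =>
    obtain ⟨n, rfl⟩ := hx
    exact hgen n
  | algebraMap c =>
    have h : OreExtension.const F (algebraMap F (S.tower A) c) ∈ S.oreAlgebra A := by
      rw [AlgHom.commutes]
      exact Subalgebra.algebraMap_mem _ _
    exact h
  | add x y hx hy ihx ihy =>
    have h := add_mem ihx ihy
    rwa [← map_add] at h
  | mul x y hx hy ihx ihy =>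
    have h := mul_mem ihx ihy
    rwa [← map_mul] at h
  | inv x hx ih =>
    have h := Subalgebra.smul_mem (S.oreAlgebra A) ih (S.sq x)⁻¹
    rw [← map_smul] at h
    convert h using 2
    refine Subtype.ext ?_
    change x⁻¹ = (S.sq x)⁻¹ • x
    rw [Algebra.smul_def, map_inv₀, S.algebraMap_sq]
    field_simp

theorem isTwoSidedNoetherian_oreAlgebra (A : ℕ → Bool) : IsTwoSidedNoetherian (S.oreAlgebra A) :=
  OreExtension.isTwoSidedNoetherian_alg (S.const_mem_oreAlgebra A)

/-- The square of `gen (n, b)` has a square root in the Ore extension if and only if `A n = b`. -/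
theorem exists_sqrt_oreAlgebra_iff (A : ℕ → Bool) (n : ℕ) (b : Bool) :
    (∃ u : S.oreAlgebra A, u * u = algebraMap F _ (S.sq (S.gen (n, b)))) ↔ A n = b := by
  constructor
  · intro h
    obtain ⟨a, ha⟩ := OreExtension.exists_mul_self_eq h
    have ha' : (a : L) * a = S.gen (n, b) * S.gen (n, b) :=
      (congrArg Subtype.val ha).trans (S.algebraMap_sq _)
    have := S.eq_of_mul_self_eq _ _ ha'
    exact S.gen_mem_tower_iff.1 (this ▸ a.2)
  · rintro rfl
    refine ⟨⟨_, S.const_mem_oreAlgebra A (S.towerGen A n)⟩, Subtype.ext ?_⟩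
    have h := (OreExtension.const F (K := S.tower A)).commutes (S.sq (S.gen (n, A n)))
    refine Eq.trans ?_ h
    refine (map_mul (OreExtension.const F) (S.towerGen A n) (S.towerGen A n)).symm.trans ?_
    exact congrArg _ (Subtype.ext (S.algebraMap_sq _).symm)

theorem exists_mul_self_of_algEquiv {R A B : Type*} [CommSemiring R] [Semiring A] [Semiring B]
    [Algebra R A] [Algebra R B] (e : A ≃ₐ[R] B) {c : R} (h : ∃ u : A, u * u = algebraMap R A c) :
    ∃ u : B, u * u = algebraMap R B c := by
  obtain ⟨u, hu⟩ := h
  exact ⟨e u, by rw [← map_mul, hu, e.commutes]⟩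

/-- An `F`-algebra isomorphism fixes scalars, so it preserves which of them have square roots. -/
theorem eq_of_algEquiv {A A' : ℕ → Bool} (e : S.oreAlgebra A ≃ₐ[F] S.oreAlgebra A') :
    A = A' := by
  funext n
  exact ((S.exists_sqrt_oreAlgebra_iff A' n (A n)).1
    (exists_mul_self_of_algEquiv e ((S.exists_sqrt_oreAlgebra_iff A n (A n)).2 rfl))).symm

end SquareRootSystem

/-! ### Comparing the two counts -/

theorem corollary1p4 :
    ∃ (F : Type) (_ : Field F), Countable F ∧
      Cardinal.mk (isoClasses F fun A => Algebra.FiniteType F A ∧ IsTwoSidedNoetherian A ∧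
        ¬ HasNoetherianFiltration F A) = Cardinal.continuum ∧
      (isoClasses F fun A => Algebra.FiniteType F A ∧ HasNoetherianFiltration F A).Countable := by
  obtain ⟨F, L, _, _, _, hF, ⟨S⟩⟩ := SquareRootSystem.exists_countable
  have hcount := countable_isoClasses_hasNoetherianFiltration F
  refine ⟨F, inferInstance, hF,
    le_antisymm (mk_isoClasses_finiteType_le _ _ fun A h => h.1) ?_, hcount⟩
  let c : (ℕ → Bool) → Quotient (algIsoSetoid F) := fun A =>
    Quotient.mk _ (AlgCat.of F (S.oreAlgebra A))
  have hc : Function.Injective c := fun A A' h =>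
    let ⟨e⟩ := Quotient.exact h
    S.eq_of_algEquiv e
  -- Only countably many `A` can give an algebra with a Noetherian filtration, since `c` is
  -- injective; the complement still has the cardinality of the continuum.
  have hbad := hcount.preimage hc
  set bad := c ⁻¹' isoClasses F fun A =>
    Algebra.FiniteType F A ∧ HasNoetherianFiltration F A
  have hmk : Cardinal.mk (ℕ → Bool) = Cardinal.continuum := by simp
  have hgood : Cardinal.mk (badᶜ : Set (ℕ → Bool)) = Cardinal.continuum := by
    rw [Cardinal.mk_compl_of_infinite, hmk]
    rw [hmk]
    exact hbad.le_aleph0.trans_lt Cardinal.aleph0_lt_continuum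
  have himage : c '' badᶜ ⊆ isoClasses F fun A => Algebra.FiniteType F A ∧
      IsTwoSidedNoetherian A ∧ ¬ HasNoetherianFiltration F A := by
    rintro _ ⟨A, hA, rfl⟩
    have hft := S.finiteType_oreAlgebra A
    exact ⟨_, ⟨hft, S.isTwoSidedNoetherian_oreAlgebra A, fun h => hA ⟨_, ⟨hft, h⟩, rfl⟩⟩, rfl⟩
  have h := Cardinal.mk_image_eq_lift c badᶜ hc
  rw [Cardinal.lift_id', hgood, Cardinal.lift_continuum] at h
  rw [← h]
  exact Cardinal.mk_le_mk_of_subset himage
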